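/- All graphs are finite and simple. For a graph $G$ and $A\subseteq V(G)$ let $M_G(A)$ be the set of vertices that lie in $A$ or have a neighbor in $A$. A vertex $k$-multicoloring of $G$ is a function $\kappa:V(G)\to\mathcal P(\{1,\dots,k\})$. It is called highly $a$-resistant if for every $A\subseteq V(G)$ with $|A|=a$ both of the following hold: (i) the graph $G\setminus M_G(A)$, obtained from $G$ by deleting the vertices in $M_G(A)$, has a connected component $H$ with $\bigcup_{u\in V(H)}\kappa(u)=\{1,\dots,k\}$; (ii) $\bigcup_{u\in A}\kappa(u)\neq\{1,\dots,k\}$. Let $K(a,n)$ be the least $k$ such that some graph with $n$ vertices admits a highly $a$-resistant vertex $k$-multicoloring, and $K(a,n)=\infty$ if there is no such $k$. **Theorem.** $K(4,21)=10$. That is, some graph with $21$ vertices admits a highly $4$-resistant vertex $10$-multicoloring, and for $k\le 9$ no graph with $21$ vertices admits a highly $4$-resistant vertex $k$-multicoloring. -/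

import Mathlib

namespace SecretMulticoloring

variable {V : Type*}

/-- `M(A)`: the union, over `u ∈ A`, of the closed neighborhoods `N(u) ∪ {u}`. -/
def closedNbhd (G : SimpleGraph V) (A : Set V) : Set V :=
  ⋃ u ∈ A, insert u (G.neighborSet u)

/-- `G \ A`: the graph obtained from `G` by deleting the vertices in `A`. -/
abbrev deleteVertices (G : SimpleGraph V) (A : Set V) : SimpleGraph (Aᶜ : Set V) :=
  G.induce Aᶜ

/-- A vertex `k`-multicoloring: every vertex gets a (possibly empty) subset of the `k` colors. -/
abbrev Multicoloring (V : Type*) (k : ℕ) : Type _ := V → Set (Fin k)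

/-- The set `S` of vertices has all `k` colors. -/
def HasAllColors {k : ℕ} (κ : Multicoloring V k) (S : Set V) : Prop :=
  (⋃ u ∈ S, κ u) = Set.univ

/-- `κ` is `a`-resistant: for every set `A` of `a` vertices, some connected component of
`G \ M(A)` has all the colors. -/
def IsResistant (G : SimpleGraph V) (a : ℕ) {k : ℕ} (κ : Multicoloring V k) : Prop :=
  ∀ A : Finset V, A.card = a →
    ∃ H : (deleteVertices G (closedNbhd G (A : Set V))).ConnectedComponent,
      HasAllColors κ (Subtype.val '' H.supp)

/-- `κ` is highly `a`-resistant: it is `a`-resistant and no set of `a` vertices has all the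
colors. -/
def IsHighlyResistant (G : SimpleGraph V) (a : ℕ) {k : ℕ} (κ : Multicoloring V k) : Prop :=
  IsResistant G a κ ∧ ∀ A : Finset V, A.card = a → ¬ HasAllColors κ (A : Set V)

/-- Some graph with `n` vertices admits a highly `a`-resistant vertex `k`-multicoloring. -/
def Admits (a n k : ℕ) : Prop :=
  ∃ (G : SimpleGraph (Fin n)) (κ : Multicoloring (Fin n) k), IsHighlyResistant G a κ

/-- `K(a,n)`: the least number `k` of colors such that some graph with `n` vertices admits a
highly `a`-resistant vertex `k`-multicoloring, and `∞` if there is no such `k`. -/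
noncomputable def K (a n : ℕ) : ℕ∞ :=
  sInf {m : ℕ∞ | ∃ k : ℕ, m = (k : ℕ∞) ∧ Admits a n k}

end SecretMulticoloring

namespace SecretMulticoloring

variable {V : Type*}

/-! ### Partially explored graphs -/

/-- A partially explored graph on the labels `0, 1, …`: the entry of a label consists of the bit
mask of its known neighbors and of a bound for the number of its unknown neighbors. -/
abbrev Exploration : Type := List (ℕ × ℕ)

namespace Exploration

def adjMask (s : Exploration) (i : ℕ) : ℕ := (s.getD i (0, 0)).1

def slack (s : Exploration) (i : ℕ) : ℕ := (s.getD i (0, 0)).2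

/-- Declare the labels `u` and `w` to be adjacent. -/
def addEdge (s : Exploration) (u w : ℕ) : Exploration :=
  (s.set u (s.adjMask u ||| 1 <<< w, s.slack u - 1)).set w
    (s.adjMask w ||| 1 <<< u, s.slack w - 1)

/-- Give the label `u` exactly `k` further neighbors, all of them new. -/
def addLeaves (s : Exploration) (u k : ℕ) : Exploration :=
  s.set u (s.adjMask u ||| (1 <<< k - 1) <<< s.length, 0) ++ List.replicate k (1 <<< u, 2)

/-- The possible explorations after one more look at the neighbors of `u`. -/
def children (s : Exploration) (u : ℕ) : List Exploration :=
  ((List.range s.length).filter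
    (fun w => w != u && s.slack w != 0 && !(s.adjMask u).testBit w)).map (s.addEdge u) ++
  (List.range (s.slack u + 1)).map (s.addLeaves u)

/-- The mask of the known part of the closed neighborhood of the labels in the mask `A`. -/
def nbhdMask (s : Exploration) (A : ℕ) : ℕ :=
  (List.range s.length).foldr
    (fun i acc => (if A.testBit i then s.adjMask i ||| 1 <<< i else 0) ||| acc) 0

def bitCount (m A : ℕ) : ℕ := ((List.range m).filter (fun i => A.testBit i)).length

/-- The labels in `Z` are completely explored and separated by the closed neighborhood `M(A)`,
and `M(A) ∪ Z` has more than `4|A|` labels. -/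
def isGain (s : Exploration) (A Z : ℕ) : Bool :=
  Nat.ble (bitCount s.length A) 3 && Nat.ble (bitCount s.length Z) 4 &&
  Nat.ble (4 * bitCount s.length A + 1) (bitCount s.length (s.nbhdMask A ||| Z)) &&
  (List.range s.length).all (fun i => !Z.testBit i ||
    (s.slack i == 0 && (s.adjMask i ||| (s.nbhdMask A ||| Z)) == (s.nbhdMask A ||| Z)))

/-- The completely explored cycle of length `8`. -/
def octagon : Exploration :=
  [(6, 0), (9, 0), (17, 0), (34, 0), (68, 0), (136, 0), (144, 0), (96, 0)]

/-- Check a search tree, given in preorder: an even code `2u` is a branching at the label `u`, an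
odd code stands for a leaf and encodes the masks `A` and `Z` of a gain. -/
def verify : ℕ → Exploration → List ℕ → Option (List ℕ)
  | 0, _, _ => none
  | _ + 1, _, [] => none
  | f + 1, s, c :: cs =>
    if c % 2 = 0 then
      if c / 2 < s.length then
        (s.children (c / 2)).foldl (fun o t => o.bind (verify f t)) (some cs)
      else none
    else if s.isGain (c / 2 % 2 ^ 24) (c / 2 / 2 ^ 24) || decide (s = octagon) then some cs
    else none

/-- The search tree for subcubic graphs, starting at a vertex of degree at most `2`. -/
def certificate : List ℕ := [
  0, 33554433, 2, 100663297, 4, 234881025, 6, 503316481, 100663313, 100663313, 33554441, 4, 4, 6,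
  503316481, 33554449, 33554441, 6, 503316481, 167772177, 33554449, 6, 167772177, 301989897, 8,
  369098785, 536870917, 12, 771752001, 2818572291, 10, 14, 7113539601, 939524355, 1073741829,
  234881217, 100663393, 167772305, 10, 503316609, 503316737, 1073741829, 100663393, 100663393,
  33554449, 33554441, 2, 2, 4, 234881025, 6, 503316481, 100663313, 100663313, 4, 6, 503316481,
  33554449, 6, 503316481, 167772177, 167772177, 6, 167772177, 268435465, 10, 369098785,
  1342177283, 12, 1442840609, 3489660931, 8, 14, 7784628233, 1342177539, 536870917, 369098913,
  100663393, 268435593, 8, 503316609, 503316737, 536870917, 100663393, 100663393, 8, 234881089,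
  234881153, 536870917, 14, 771752001, 771752065, 4831838211, 167772433, 167772433, 33554481, 4,
  234881025, 6, 503316481, 100663313, 100663313, 67108873, 4, 4, 6, 503316481, 33554449,
  67108873, 6, 503316481, 167772177, 167772177, 6, 167772177, 335544329, 8, 369098785, 671088645,
  10, 771752001, 1342177283, 12, 12, 14, 8556380161, 805306627, 1342177411, 2684354563,
  234881217, 167772305, 100663393, 10, 503316609, 503316737, 1342177283, 100663393, 100663393, 8,
  234881089, 234881153, 671088645, 14, 771752001, 771752065, 4831838211, 167772433, 167772433,
  33554481, 6, 100663329, 100663361, 335544329, 12, 369098785, 369098817, 2415919107, 14,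
  2516582433, 2516582465, 6710886403, 335544585, 335544585, 67109001, 8, 8, 10, 3892314117,
  1778384913, 1778384913, 33554513, 10, 1778384913, 6039797765, 1778384913, 33554513, 10,
  1778384913, 1778384913, 1610612739, 33554513, 33554481, 8, 10, 3892314117, 1778384913,
  1778384913, 33554513, 369098785, 10, 234881153, 10, 1778384913, 1778384913, 570425425,
  1778384913, 570425425, 33554513, 10, 234881153, 369098849, 570425425, 1073741857, 18,
  1308622977, 100663585, 1241514513, 18253611011, 234882177, 234882177, 33554513, 8, 10,
  1778384913, 6039797765, 1778384913, 33554513, 369098785, 10, 10, 1778384913, 1778384913,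
  570425425, 234881281, 1778384913, 570425425, 33554513, 10, 369098849, 234881281, 570425425,
  1073741857, 18, 100663457, 1308623105, 1241514513, 18253611011, 234882305, 234882305, 33554513,
  10, 771752065, 771752193, 1610612739, 570425425, 536870977, 10, 16, 536870977, 771752065,
  637534529, 9126805507, 234881665, 234881665, 16, 536870977, 637534401, 771752193, 9126805507,
  234881793, 234881793, 570425425, 1107296305, 16, 637534401, 637534529, 1241514513, 9126805507,
  18, 1174405281, 1174405409, 9261024261, 18253611011, 20, 8657043593, 8657043721, 18790483971,
  43486543875, 704646161, 570427473, 167773713, 18, 1174405281, 1174405409, 1744832517,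
  1744834565, 18253611011, 167773713, 167773713, 33554513, 33554481, 4, 6, 33554449, 4,
  134217733, 134217733, 8, 436207649, 805306371, 12, 905969729, 2684354563, 10, 14, 7046430729,
  805306627, 1342177283, 369098945, 301989985, 67109001, 10, 503316609, 503316737, 1342177283,
  301989985, 33554529, 33554449, 8, 33554465, 4, 134217733, 134217733, 6, 704643089, 805306371,
  12, 905969729, 2415919107, 10, 14, 6777995273, 805306627, 1610612739, 637534401, 570425425,
  67109001, 10, 771752065, 771752193, 1610612739, 570425425, 33554513, 33554465, 134217733, 10,
  167772177, 167772193, 1207959557, 12, 1241514001, 1241514017, 3221225475, 14, 3388997649,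
  3388997665, 7516192771, 1207959813, 1207959813, 134217861, 6, 6, 8, 3019898889, 905969729,
  905969729, 33554529, 8, 905969729, 5167382537, 905969729, 33554529, 8, 905969729, 905969729,
  805306371, 33554529, 33554513, 6, 8, 3019898889, 905969729, 905969729, 33554529, 1241514001, 8,
  234881153, 8, 1241514017, 905969729, 1241514033, 905969729, 301989985, 33554529, 8, 234881153,
  1241514033, 301989985, 536870929, 18, 771752065, 167772433, 637534785, 17716740099, 234882177,
  234882177, 33554529, 6, 8, 905969729, 5167382537, 905969729, 33554529, 1241514001, 8, 8,
  1241514017, 905969729, 1241514033, 234881281, 905969729, 301989985, 33554529, 8, 1241514033,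
  234881281, 301989985, 536870929, 18, 167772305, 771752193, 637534785, 17716740099, 234882305,
  234882305, 33554529, 8, 503316609, 503316737, 805306371, 301989985, 268435489, 8, 16,
  268435489, 503316609, 436207905, 8858370051, 234881665, 234881665, 16, 268435489, 436207777,
  503316737, 8858370051, 234881793, 234881793, 301989985, 570425425, 16, 436207777, 436207905,
  637534785, 8858370051, 18, 704643217, 704643345, 8925479945, 17716740099, 20, 8724152453,
  8724152581, 17985177603, 43218108419, 369101889, 301992033, 100664897, 18, 704643217,
  704643345, 872417289, 872419337, 17716740099, 100664897, 100664897, 33554529, 33554513, 6, 6,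
  8, 1879048195, 872415241, 872415241, 14, 637534273, 14, 5167382537, 5167382537, 335544585,
  4294967301, 335544585, 335544585, 8, 872415241, 2952790019, 872415241, 14, 14, 5167382537,
  5167382537, 335544585, 637534337, 4294967301, 335544585, 335544585, 8, 872415241, 872415241,
  805306371, 14, 905969729, 905969793, 5100273667, 335544585, 335544585, 8, 14, 369098817, 14,
  5167382537, 5167382537, 603980041, 4294967301, 603980041, 603980041, 14, 14, 5167382537,
  5167382537, 603980041, 369098881, 4294967301, 603980041, 603980041, 14, 5167382537, 5167382537,
  5100273667, 67109129, 14, 905969729, 905969793, 5100273667, 603980041, 603980041, 14, 16,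
  905969729, 905969857, 4294967337, 8589934597, 369099329, 369099329, 16, 905969857, 905969793,
  4294967337, 8589934597, 369099393, 369099393, 603980041, 4294967301, 16, 637534529, 637534593,
  4630512137, 8589934597, 18, 4328521825, 4328521889, 9395241987, 21474836485, 20, 8623489105,
  8623489169, 22280144899, 42949672965, 872418313, 603982089, 335545865, 18, 4328521825,
  4328521889, 5100275715, 5100277763, 21474836485, 335545865, 335545865, 16, 637534529,
  637534593, 872416265, 872417289, 8589934597, 22, 8623489105, 8623489169, 9395241987,
  9395243011, 77309411333, 603984137, 603984137, 67109641, 10, 100663361, 12, 3489660931,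
  3355443205, 3355443205, 14, 2315255825, 14, 7650410501, 7650410501, 1207959813, 7650410501,
  1207959813, 1207959813, 12, 167772177, 12, 3355443205, 3355443205, 6, 872415241, 1442840705,
  1342177283, 33554577, 3355443205, 14, 2315255825, 14, 7650410501, 7650410501, 1207959813,
  6442450947, 1207959813, 1207959813, 1073741957, 8, 8, 872415241, 637534273, 872415241, 16,
  637534401, 872415497, 8589934597, 335544841, 335544841, 8, 872415241, 6, 167772177, 5167382537,
  1509949473, 167772209, 12, 872415241, 2785017921, 2684354563, 100663489, 33554529, 8,
  637534273, 6, 167772177, 5167382537, 1509949473, 167772209, 637534273, 16, 268435497,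
  637534401, 16, 4831838225, 12884901901, 13421772817, 100663873, 8589934597, 100663873,
  100663873, 637534273, 16, 536870929, 637534401, 16, 536870929, 1207960069, 9227468865,
  100663873, 9126805507, 100663873, 100663873, 33554529, 12, 100663425, 10, 3489660931,
  3355443205, 3355443205, 14, 1241514001, 14, 7650410501, 7650410501, 2281701637, 7650410501,
  2281701637, 2281701637, 10, 167772177, 10, 3355443205, 3355443205, 6, 872415241, 2516582465,
  2415919107, 33554513, 3355443205, 14, 1241514001, 14, 7650410501, 7650410501, 2281701637,
  5368709123, 2281701637, 2281701637, 2147483717, 8, 8, 872415241, 637534337, 872415241, 16,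
  637534401, 872415497, 8589934597, 335544841, 335544841, 8, 872415241, 6, 167772177, 5167382537,
  2583691297, 167772209, 10, 872415241, 1711276161, 1610612739, 100663489, 33554593, 8,
  637534337, 6, 167772177, 5167382537, 2583691297, 167772209, 637534337, 16, 268435497,
  637534401, 16, 4831838225, 12884901901, 13421772817, 100663937, 8589934597, 100663937,
  100663937, 637534337, 16, 536870929, 637534401, 16, 536870929, 2281701893, 9227468929,
  100663937, 9126805507, 100663937, 100663937, 33554593, 8, 369098817, 369098881, 805306371, 14,
  905969729, 905969793, 4831838211, 335544585, 335544585, 268435489, 14, 8, 268435489, 268435489,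
  14, 5167382537, 5167382537, 5100273667, 67109129, 268435489, 8, 369098817, 8, 167772193,
  5167382537, 14, 5167382537, 5167382537, 603980041, 301989985, 8, 6174015491, 5167382537,
  5167382537, 268435489, 905969729, 16, 905969729, 905969857, 4563402793, 9126805507, 369099329,
  369099329, 301989985, 8, 8, 167772193, 5167382537, 14, 5167382537, 5167382537, 603980041,
  301990049, 369098881, 8, 5167382537, 7247757315, 5167382537, 268435489, 905969793, 16,
  905969857, 905969793, 4563402793, 9126805507, 369099393, 369099393, 301990049, 4563402755, 16,
  4563402785, 8, 4664066113, 4596957281, 4563402785, 5167382601, 4596957281, 4563402849, 8,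
  4596957345, 4664066177, 4563402785, 5167382665, 4596957345, 4563402913, 13153337347, 18,
  13153337377, 12884901957, 12884902021, 30333206531, 20, 30333206561, 30333206595, 30333206659,
  64424509445, 13153339395, 13153339395, 4563403779, 8, 369099329, 369099393, 4630512649,
  4630513673, 805306883, 22, 637534529, 637534593, 5100274691, 5100275715, 69256347651,
  335548937, 335548937, 268436001, 8, 100663617, 100663681, 335544841, 335545353, 603980041, 20,
  637534529, 637534593, 872415753, 872416265, 34896609283, 22, 34930163793, 34930163857,
  35165045251, 35165045763, 103616086019, 603984137, 603984137, 67111177, 20, 12, 12, 33554593,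
  33554593, 37715181573, 3388997665, 3388997665, 33554593, 503319041, 503319553, 167774225, 10,
  3388997665, 503321089, 503321601, 570425425, 12, 1107296417, 1107296417, 3388997665,
  3388997665, 1107296417, 637534657, 2315257873, 10, 1107296673, 1107296673, 570425425,
  2147483713, 1107296417, 24, 2449474145, 2449474657, 2281703429, 100667713, 2281717765,
  139586437123, 234891521, 234891521, 33554593, 10, 10, 33554529, 33554529, 37715181573,
  3388997665, 3388997665, 33554529, 503319041, 503319553, 167774225, 10, 3388997665, 503319041,
  503319553, 570425425, 12, 1107296417, 1107296417, 3388997665, 3388997665, 1107296417,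
  637534657, 1241516049, 12, 2181038433, 2181038433, 570425489, 1073741953, 2181038177, 24,
  1375732385, 1375732897, 1207961605, 100667777, 1207975941, 138512695299, 234891521, 234891521,
  33554529, 18, 4664068161, 4664068225, 18, 30333206569, 30333206569, 64424509445, 30333206561,
  30333206561, 268436513, 4563404803, 16, 4664070209, 4664070273, 30333206561, 805306883, 18,
  30333206569, 30333206569, 30333206561, 30333206561, 8858371105, 872416777, 21743273987, 16,
  8858371113, 8858371113, 805306883, 17179869697, 8858371105, 24, 17481859681, 17481859745,
  21743273987, 335548937, 21743288323, 154618822673, 4630521865, 4630521865, 268436513, 16,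
  4664068161, 4664068225, 16, 30333206569, 30333206569, 64424509445, 30333206561, 30333206561,
  268436001, 4563404803, 16, 4664068161, 4664068225, 30333206561, 805306883, 18, 30333206569,
  30333206569, 30333206561, 30333206561, 8858371105, 872416777, 13153339395, 18, 17448305193,
  17448305193, 805307395, 8589935617, 17448305185, 24, 8891925601, 8891925665, 13153339395,
  335549449, 13153353731, 146028888081, 4630521865, 4630521865, 268436001, 20, 22, 104689827843,
  103079215117, 103683195145, 103683195145, 103079215117, 67113225, 22, 103079215117,
  105763569667, 103683195145, 103683195145, 103079215117, 67113225, 22, 103683195145,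
  103683195145, 112206020625, 103616086275, 103616086275, 67113225, 22, 103683195145,
  103683195145, 103616086275, 120795955217, 103616086275, 67113225, 22, 103079215117,
  103079215117, 103616086275, 103616086275, 103616086019, 67113225, 67111177, 34359738373, 22,
  22, 167776273, 68786587913, 68786587913, 34359742465, 68786587913, 24, 34359738437,
  34997273025, 34695287305, 34695287817, 69323464969, 171798691845, 637542721, 637542721, 22,
  167776273, 68786587913, 68786587913, 34359742465, 68786587913, 24, 34997273025, 34359738501,
  34695287305, 34695287817, 69323464969, 171798691845, 637542785, 637542785, 22, 68786587913,
  68786587913, 4563406851, 34359742465, 68786587913, 24, 34460406081, 34460406145, 34896609795,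
  35232155145, 69323464969, 171798691845, 872423945, 872423945, 22, 68786587913, 68786587913,
  4563406851, 34359742465, 68786587913, 24, 34460406081, 34460406145, 35232155145, 34896610307,
  69323464969, 171798691845, 872424457, 872424457, 34426851593, 68719476741, 24, 34460406081,
  34460406145, 34695287305, 34695287817, 69323464969, 171798691845, 28, 171798691909,
  171798691973, 171798692357, 171798692869, 172335579139, 721554505733, 30, 721554505797,
  721554505861, 721554506245, 721554506757, 722091393027, 1821066133509, 171798757381,
  171798757381, 34359771141, 26, 69289910353, 69289910417, 69524791811, 69524792323,
  103616118787, 103616151555, 343597383685, 32, 343597383749, 343597383813, 343597384197,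
  343597384709, 378494025731, 378494058499, 2542620639237, 34, 2542620639301, 2542620639365,
  2542620639749, 2542620640261, 2542620672005, 2542620704773, 6940667150341, 343597645829,
  343597645829, 68719607813, 10, 10, 33554529, 33554529, 33554529, 33554529, 33554529, 33554529,
  12, 3221225731, 3221225731, 3221233667, 3221233667, 3221241859, 3221241859, 3221225475,
  33554593, 33554529, 10, 33554529, 4294967365, 33554529, 33554529, 33554529, 33554529, 16,
  134218245, 268436001, 268436001, 268436001, 268436001, 268436001, 12, 14227079299, 9697230993,
  9697230993, 9697230993, 9697230993, 3221225731, 9697230993, 9663676561, 268436001, 33554529,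
  10, 33554529, 4294967365, 33554529, 33554529, 33554529, 33554529, 18, 134218757, 268436513,
  268436513, 268436513, 268436513, 268436513, 12, 22817013891, 18287165585, 18287165585,
  18287165585, 18287165585, 3221225731, 18287165585, 18253611153, 268436513, 33554529, 10,
  33554529, 33554529, 33554529, 171798691909, 33554529, 33554529, 1610637315, 33554529, 10,
  33554529, 33554529, 33554529, 171798691909, 33554529, 33554529, 1610637315, 33554529, 10,
  33554529, 33554529, 33554529, 33554529, 33554529, 343597383749, 1610637315, 33554529, 10,
  33554529, 33554529, 33554529, 33554529, 33554529, 343597383749, 1610637315, 33554529,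
  1610637315, 36, 1107296417, 12, 1342177795, 1375732385, 35567731205, 35567763973, 69927567877,
  69927698949, 134742021, 3489661443, 1375732385, 33554593, 12, 1375732897, 1342178307,
  35567731717, 35567764485, 69927568389, 69927699461, 134742021, 3489661955, 1375732897,
  33554593, 35970400259, 35970433027, 70330228739, 70330359811, 8797166764035, 38, 8797166764161,
  8797435200003, 8797435200515, 8832063422467, 8832063455235, 8866423250947, 8866423382019,
  26389352808451, 12, 436732449, 436732961, 35568779269, 35568812037, 69928615941, 69928747013,
  26389352808577, 2282225669, 40, 26389352808963, 26389352809475, 26389352841219, 26389352873987,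
  26389352939523, 26389353070595, 8799316344835, 61573724897283, 8797202415777, 8797168861187,
  33554593, 12, 1209008645, 1209009157, 1209040901, 1209073669, 1209139205, 1209270277,
  8797303078917, 8797305176069, 3222274051, 1108344993, 33554593, 12, 168296993, 168297505,
  34494513157, 34494545925, 68854349829, 68854480901, 1209008133, 1210056709, 2282225669, 42,
  2282226181, 2282226693, 37044142083, 37044174851, 71403970563, 71404101635, 3356491781,
  3357540357, 70370891661315, 172490785, 138936325, 33554593, 33554529, 67113225, 67111177, 10,
  8, 167772193, 536870937, 536870937, 536870937, 12, 33554513, 167772449, 167772705, 12,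
  2315255841, 2315255857, 2315255857, 2315255841, 33554577, 2315255841, 20, 2147483713,
  2315256097, 2315256353, 20, 36674994209, 36674994225, 36674994225, 36674994209, 167774241,
  36507222019, 167774241, 167774241, 33554577, 10, 33554513, 12, 3355443221, 7650410501,
  3388997649, 3388997649, 33554577, 12, 3355443221, 3388997649, 11945377797, 3388997649,
  33554577, 12, 3355443205, 3388997649, 3388997649, 3221225475, 33554577, 33554513, 10, 16,
  536870937, 369098945, 16, 4563402785, 12884901901, 13153337377, 100663873, 8589934597,
  100663873, 100663873, 12, 3355443221, 7650410501, 3388997649, 3388997649, 33554577, 8,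
  1241514033, 8, 536870937, 536870929, 536870929, 301989985, 8, 536870937, 536870929, 536870929,
  301989985, 536870929, 301989985, 33554529, 12, 1241514033, 12, 7650410501, 3388997649,
  7650410501, 1073741953, 12, 3355443221, 3388997649, 3388997649, 1107296401, 3388997649,
  1107296401, 33554577, 8, 8, 536870937, 536870937, 1241514033, 536870937, 33554529, 12,
  536870937, 100663681, 5368709253, 2147483713, 100663681, 33554577, 301989985, 8, 1241514033,
  570425425, 570425425, 570425425, 12, 1107296417, 234882561, 1107296401, 234883329, 2147483713,
  22, 2281701637, 2382366209, 2281702405, 2382366977, 70866960387, 1241518129, 1241518129,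
  33554577, 536870929, 20, 570425489, 603980041, 603980297, 20, 570425489, 34359738437,
  603980297, 34359738437, 12, 167772449, 771753473, 134218757, 771756289, 2147483713, 1107298449,
  33554577, 34896609283, 22, 34896609425, 34896609539, 34963718665, 34896610321, 103616086019,
  24, 103079215237, 103616086275, 103616086531, 103616087043, 241055039491, 34896617489,
  34896617475, 536875025, 12, 167772449, 369100993, 1107296401, 771756289, 771760385, 2147483713,
  26, 2281701637, 100665921, 2281702405, 2717913169, 2717917265, 277025390595, 234899713,
  234899713, 33554577, 33554529, 10, 14, 536870937, 369098945, 14, 8858370081, 12884901901,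
  13153337377, 100663617, 4294967301, 100663617, 100663617, 12, 3355443221, 3388997649,
  11945377797, 3388997649, 33554577, 8, 1241514033, 8, 536870937, 536870929, 536870929,
  301989985, 8, 536870937, 536870929, 536870929, 301989985, 536870929, 301989985, 33554529, 12,
  1241514033, 12, 3355443221, 3388997649, 3388997649, 1107296401, 12, 11945377797, 3388997649,
  11945377797, 1073741953, 3388997649, 1107296401, 33554577, 8, 8, 536870937, 536870937,
  1241514033, 536870937, 33554529, 301989985, 12, 536870937, 100663937, 9663676549, 2147483713,
  100663937, 33554577, 8, 1241514033, 570425425, 570425425, 570425425, 12, 234882305, 1107296417,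
  1107296401, 234883585, 2147483713, 22, 2382365953, 2281701893, 2281702405, 2382367233,
  70866960387, 1241518129, 1241518129, 33554577, 536870929, 20, 570425489, 603980041, 603980297,
  20, 570425489, 603980041, 34359738437, 34359738437, 12, 771753217, 167772705, 134218757,
  771756545, 2147483713, 1107298449, 33554577, 34896609283, 22, 34896609425, 34963718409,
  34896609795, 34896610321, 103616086019, 24, 103079215237, 103616086275, 103616086531,
  103616087043, 241055039491, 34896617489, 34896617475, 536875025, 12, 369100993, 167772705,
  1107296401, 771756545, 771760641, 2147483713, 26, 100665665, 2281701893, 2281702405,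
  2717913169, 2717917265, 277025390595, 234899969, 234899969, 33554577, 33554529, 12, 1241514017,
  12, 1241514017, 3388997649, 3388997649, 1073741953, 12, 1241514017, 3388997649, 3388997649,
  1073741953, 3221225475, 1107296401, 1073741953, 12, 18, 1241514017, 1073741953, 1241514273,
  1241514529, 18253611011, 8, 536870937, 536870937, 18421383201, 536870937, 167773217, 167773217,
  12, 16, 536870937, 16, 4563402785, 15032385605, 13153337377, 100663937, 1241514529, 8589934597,
  100663937, 100663937, 2181038161, 1073741953, 2181038161, 18, 1107296417, 1207959813, 18,
  1107296417, 1207959813, 1207961605, 17179869209, 8, 100663617, 67109385, 1308625409,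
  1308627201, 536870929, 301991073, 33554593, 1207961605, 18253611011, 22, 18253611169,
  18253611267, 18253611649, 18387830789, 86973087747, 24, 85899345961, 86973088003, 86973088259,
  86973089795, 224412041219, 18253619329, 18253619203, 1073746049, 8, 100663617, 301990049,
  2315256881, 1308627201, 1308631297, 536870929, 26, 603980041, 603980297, 167775249, 1644171409,
  1644175505, 275414777859, 234898689, 234898689, 33554593, 12, 14, 536870937, 14, 8858370081,
  15032385605, 13153337377, 100663681, 1241514273, 4294967301, 100663681, 100663681, 2181038161,
  1073741953, 2181038161, 18, 1107296417, 18, 1107296417, 1207960069, 1207961605, 17179869209, 8,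
  67109129, 100663873, 1308625153, 1308627457, 536870929, 301991073, 33554593, 1207960069,
  1207961605, 18253611011, 22, 18253611169, 18253611393, 18253611523, 18387830789, 86973087747,
  24, 85899345961, 86973088003, 86973088259, 86973089795, 224412041219, 18253619329, 18253619203,
  1073746049, 8, 301990049, 100663873, 2315256881, 1308627457, 1308631553, 536870929, 26,
  603980041, 603980297, 167775249, 1644171409, 1644175505, 275414777859, 234898945, 234898945,
  33554593, 1107296401, 2181038161, 18, 8, 570425425, 570425425, 3388997665, 570425425,
  1107296417, 18, 8, 18790481939, 18790481939, 3388997665, 18790481939, 1107296417, 17179869209,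
  2281702405, 17179869209, 20, 3388997921, 3221225731, 20, 3388997921, 3221225731, 3355447301,
  34359738393, 134220805, 3355447301, 36507222019, 24, 36540776545, 36507222275, 36641441285,
  37580967939, 173946175491, 2281710597, 3355451653, 134220805, 18, 8, 18790481939, 18790481939,
  3388997665, 18790481939, 1107296417, 17179869209, 2281702405, 17179869209, 20, 3388998177, 20,
  3388998177, 3221225987, 3355447301, 34359738393, 134220805, 3221225987, 3355447301,
  36507222019, 24, 36540776545, 36641441029, 36507222531, 37580967939, 173946175491, 2281710597,
  3355451909, 134220805, 2281702405, 18253611011, 22, 18287165601, 22, 18287165601, 86973087763,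
  3221229571, 86973087763, 20, 2315256865, 18253611267, 3355447813, 20401102851, 36507222019,
  1207965701, 18387831045, 22, 18287165601, 86973087763, 3221229571, 86973087763, 20, 2315256865,
  3355447557, 18253611523, 20401102851, 36507222019, 1207965701, 18387831301, 18387830789,
  86973087747, 24, 85899345961, 86973088003, 86973088259, 86973089795, 224412041219, 18287173777,
  18253619203, 1107300497, 20, 2315256865, 20, 2315256865, 34359738393, 3355447301, 3355451397,
  34359738393, 134220805, 20, 2315256865, 34359738393, 3355447301, 3355451397, 34359738393,
  134220805, 3355447301, 3355451397, 36507222019, 167775249, 134220805, 33554577, 33554513]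

theorem verify_certificate : verify 60 [(0, 2)] certificate = some [] := by
  decide +kernel

end Exploration

theorem mem_closedNbhd {G : SimpleGraph V} {A : Finset V} {w : V} :
    w ∈ closedNbhd G (A : Set V) ↔ ∃ a ∈ A, w = a ∨ G.Adj a w := by
  simp [closedNbhd]

open Classical in
/-- The neighbors of `v` in `X`. -/
noncomputable def nbrs (G : SimpleGraph V) (X : Finset V) (v : V) : Finset V :=
  X.filter (G.Adj v)

open Classical in
/-- `X \ M(A)`. -/
noncomputable def remove (G : SimpleGraph V) (A X : Finset V) : Finset V :=
  X.filter (· ∉ closedNbhd G (A : Set V))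

open Classical in
/-- There are sets `A` and `Z` of at most three and four vertices such that no edge joins `Z` to
the rest of `X \ M(A)`, and `M(A) ∪ Z` has more than `4|A|` vertices in `X`. -/
def HasGain (G : SimpleGraph V) (X : Finset V) : Prop :=
  ∃ A Z : Finset V, A.card ≤ 3 ∧ Z.card ≤ 4 ∧ Z ⊆ X ∧
    (∀ z ∈ Z, ∀ w ∈ X, G.Adj z w → w ∈ Z ∨ w ∈ closedNbhd G (A : Set V)) ∧
    (remove G A X \ Z).card + (4 * A.card + 1) ≤ X.card

namespace Exploration

open Classical in
/-- `φ` identifies the labels of `s` with vertices in `X`, and what `s` says about them is true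
in the subgraph of `G` induced by `X`. -/
structure Realizes (G : SimpleGraph V) (X : Finset V) (s : Exploration) (φ : ℕ → V) : Prop where
  mem : ∀ i < s.length, φ i ∈ X
  inj : ∀ i < s.length, ∀ j < s.length, φ i = φ j → i = j
  symm : ∀ i j, (s.adjMask i).testBit j → (s.adjMask j).testBit i
  adj : ∀ i j, (s.adjMask i).testBit j → G.Adj (φ i) (φ j)
  slack : ∀ i < s.length,
    ((nbrs G X (φ i)).filter (fun w => ∀ j, (s.adjMask i).testBit j → w ≠ φ j)).card ≤ s.slack i

theorem adjMask_of_length_le {s : Exploration} {i : ℕ} (h : s.length ≤ i) : s.adjMask i = 0 := by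
  rw [adjMask, List.getD_eq_default _ _ h]

theorem lt_length_of_testBit {s : Exploration} {i j : ℕ} (h : (s.adjMask i).testBit j) :
    i < s.length := by
  by_contra hi
  simp [adjMask_of_length_le (not_lt.mp hi)] at h

theorem adjMask_set (s : Exploration) {u : ℕ} (hu : u < s.length) (p : ℕ × ℕ) (i : ℕ) :
    adjMask (s.set u p) i = if i = u then p.1 else s.adjMask i := by
  unfold adjMask
  rcases eq_or_ne i u with rfl | h
  · simp [List.getD_eq_getElem?_getD, hu]
  · simp [List.getD_eq_getElem?_getD, h, List.getElem?_set_ne h.symm]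

theorem slack_set (s : Exploration) {u : ℕ} (hu : u < s.length) (p : ℕ × ℕ) (i : ℕ) :
    slack (s.set u p) i = if i = u then p.2 else s.slack i := by
  unfold slack
  rcases eq_or_ne i u with rfl | h
  · simp [List.getD_eq_getElem?_getD, hu]
  · simp [List.getD_eq_getElem?_getD, h, List.getElem?_set_ne h.symm]

theorem length_addEdge (s : Exploration) (u w : ℕ) : (s.addEdge u w).length = s.length := by
  simp [addEdge]

theorem adjMask_addEdge (s : Exploration) {u w : ℕ} (hu : u < s.length) (hw : w < s.length)
    (i : ℕ) : (s.addEdge u w).adjMask i =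
      if i = w then s.adjMask w ||| 1 <<< u else if i = u then s.adjMask u ||| 1 <<< w
      else s.adjMask i := by
  rw [addEdge, adjMask_set _ (by simpa using hw), adjMask_set _ hu]

theorem slack_addEdge (s : Exploration) {u w : ℕ} (hu : u < s.length) (hw : w < s.length)
    (i : ℕ) : (s.addEdge u w).slack i =
      if i = w then s.slack w - 1 else if i = u then s.slack u - 1 else s.slack i := by
  rw [addEdge, slack_set _ (by simpa using hw), slack_set _ hu]

theorem length_addLeaves (s : Exploration) (u k : ℕ) :
    (s.addLeaves u k).length = s.length + k := by
  simp [addLeaves]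

theorem adjMask_addLeaves (s : Exploration) {u : ℕ} (hu : u < s.length) (k i : ℕ) :
    (s.addLeaves u k).adjMask i =
      if i < s.length then
        if i = u then s.adjMask u ||| (1 <<< k - 1) <<< s.length else s.adjMask i
      else if i < s.length + k then 1 <<< u else 0 := by
  split_ifs with h1 h2 h3
  · refine Eq.trans ?_ ((adjMask_set s hu (s.adjMask u ||| (1 <<< k - 1) <<< s.length, 0) i).trans
      (if_pos h2))
    simp only [adjMask, addLeaves]
    rw [List.getD_append _ _ _ _ (by simpa using h1)]
  · refine Eq.trans ?_ ((adjMask_set s hu (s.adjMask u ||| (1 <<< k - 1) <<< s.length, 0) i).trans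
      (if_neg h2))
    simp only [adjMask, addLeaves]
    rw [List.getD_append _ _ _ _ (by simpa using h1)]
  · simp only [adjMask, addLeaves]
    rw [List.getD_append_right _ _ _ _ (by simpa using h1), List.length_set,
      List.getD_eq_getElem _ _ (by rw [List.length_replicate]; omega), List.getElem_replicate]
  · exact adjMask_of_length_le (by rw [length_addLeaves]; omega)

theorem slack_addLeaves (s : Exploration) {u : ℕ} (hu : u < s.length) (k : ℕ) {i : ℕ}
    (hi : i < s.length + k) :
    (s.addLeaves u k).slack i =
      if i < s.length then if i = u then 0 else s.slack i else 2 := by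
  split_ifs with h1 h2
  · refine Eq.trans ?_ ((slack_set s hu (s.adjMask u ||| (1 <<< k - 1) <<< s.length, 0) i).trans
      (if_pos h2))
    simp only [slack, addLeaves]
    rw [List.getD_append _ _ _ _ (by simpa using h1)]
  · refine Eq.trans ?_ ((slack_set s hu (s.adjMask u ||| (1 <<< k - 1) <<< s.length, 0) i).trans
      (if_neg h2))
    simp only [slack, addLeaves]
    rw [List.getD_append _ _ _ _ (by simpa using h1)]
  · simp only [slack, addLeaves]
    rw [List.getD_append_right _ _ _ _ (by simpa using h1), List.length_set,
      List.getD_eq_getElem _ _ (by rw [List.length_replicate]; omega), List.getElem_replicate]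

theorem testBit_one_shiftLeft (i j : ℕ) : (1 <<< i).testBit j = decide (i = j) := by
  rw [Nat.one_shiftLeft, Nat.testBit_two_pow]

theorem testBit_leaves (k m j : ℕ) :
    ((1 <<< k - 1) <<< m).testBit j = (decide (m ≤ j) && decide (j < m + k)) := by
  rw [Nat.one_shiftLeft, Nat.testBit_shiftLeft, Nat.testBit_two_pow_sub_one]
  by_cases h : m ≤ j
  · simp [h]; omega
  · simp [h]

theorem testBit_addEdge (s : Exploration) {u w : ℕ} (hu : u < s.length) (hw : w < s.length)
    (h : w ≠ u) (i j : ℕ) : ((s.addEdge u w).adjMask i).testBit j ↔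
      (s.adjMask i).testBit j ∨ i = u ∧ j = w ∨ i = w ∧ j = u := by
  rw [adjMask_addEdge s hu hw]
  split_ifs with h1 h2
  · subst h1
    rw [Nat.testBit_or, testBit_one_shiftLeft, Bool.or_eq_true, decide_eq_true_eq]
    refine or_congr_right ?_
    omega
  · subst h2
    rw [Nat.testBit_or, testBit_one_shiftLeft, Bool.or_eq_true, decide_eq_true_eq]
    refine or_congr_right ?_
    omega
  · simp [h1, h2]

theorem testBit_addLeaves (s : Exploration) {u : ℕ} (hu : u < s.length) (k i j : ℕ) :
    ((s.addLeaves u k).adjMask i).testBit j ↔ (s.adjMask i).testBit j ∨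
      i = u ∧ s.length ≤ j ∧ j < s.length + k ∨ s.length ≤ i ∧ i < s.length + k ∧ j = u := by
  rw [adjMask_addLeaves s hu]
  split_ifs with h1 h2 h3
  · subst h2
    rw [Nat.testBit_or, testBit_leaves, Bool.or_eq_true, Bool.and_eq_true, decide_eq_true_eq,
      decide_eq_true_eq]
    refine or_congr_right ?_
    omega
  · simp [h2]; omega
  · rw [adjMask_of_length_le (not_lt.mp h1)]
    rw [testBit_one_shiftLeft, decide_eq_true_eq, Nat.zero_testBit]
    simp only [Bool.false_eq_true, false_or]
    omega
  · rw [adjMask_of_length_le (not_lt.mp h1)]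
    simp; omega

variable {G : SimpleGraph V} {X : Finset V} {s : Exploration} {φ : ℕ → V}

theorem Realizes.lt_length (h : Realizes G X s φ) {i j : ℕ} (hij : (s.adjMask i).testBit j) :
    j < s.length :=
  lt_length_of_testBit (h.symm i j hij)

open Classical in
theorem Realizes.addEdge (h : Realizes G X s φ) {u w : ℕ} (hu : u < s.length)
    (hw : w < s.length) (hadj : G.Adj (φ u) (φ w)) (hnew : ¬(s.adjMask u).testBit w) :
    Realizes G X (s.addEdge u w) φ := by
  have hne : w ≠ u := by rintro rfl; exact G.loopless.irrefl _ hadj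
  have key : ∀ a b, a < s.length → b < s.length → G.Adj (φ a) (φ b) → ¬(s.adjMask a).testBit b →
      (∀ j, (s.adjMask a).testBit j → ((s.addEdge u w).adjMask a).testBit j) →
      ((s.addEdge u w).adjMask a).testBit b →
      ((nbrs G X (φ a)).filter
        (fun v => ∀ j, ((s.addEdge u w).adjMask a).testBit j → v ≠ φ j)).card ≤
        s.slack a - 1 := by
    intro a b ha hb hab hnab hmono hbit
    have h1 := h.slack a ha
    refine (Nat.le_sub_one_iff_lt ?_).mpr (lt_of_lt_of_le (Finset.card_lt_card ?_) h1)
    · refine lt_of_lt_of_le (Finset.card_pos.mpr ⟨φ b, ?_⟩) h1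
      simp only [nbrs, Finset.mem_filter]
      exact ⟨⟨h.mem b hb, hab⟩, fun j hj e => hnab (h.inj b hb j (h.lt_length hj) e ▸ hj)⟩
    · rw [Finset.ssubset_iff_of_subset]
      · refine ⟨φ b, ?_, ?_⟩
        · simp only [nbrs, Finset.mem_filter]
          exact ⟨⟨h.mem b hb, hab⟩, fun j hj e => hnab (h.inj b hb j (h.lt_length hj) e ▸ hj)⟩
        · simp only [Finset.mem_filter, not_and]
          intro _ h'
          exact h' b hbit rfl
      · intro v hv
        simp only [Finset.mem_filter] at hv ⊢
        exact ⟨hv.1, fun j hj => hv.2 j (hmono j hj)⟩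
  constructor
  · simpa only [length_addEdge] using h.mem
  · simpa only [length_addEdge] using h.inj
  · intro i j
    rw [testBit_addEdge s hu hw hne, testBit_addEdge s hu hw hne]
    rintro (h1 | h1 | h1)
    · exact .inl (h.symm _ _ h1)
    · exact .inr (.inr ⟨h1.2, h1.1⟩)
    · exact .inr (.inl ⟨h1.2, h1.1⟩)
  · intro i j
    rw [testBit_addEdge s hu hw hne]
    rintro (h1 | ⟨rfl, rfl⟩ | ⟨rfl, rfl⟩)
    · exact h.adj _ _ h1
    · exact hadj
    · exact hadj.symm
  · intro i hi
    rw [length_addEdge] at hi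
    rw [slack_addEdge s hu hw]
    split_ifs with h1 h2
    · subst h1
      exact key i u hi hu hadj.symm (fun h' => hnew (h.symm _ _ h'))
        (fun j hj => (testBit_addEdge s hu hw hne _ _).mpr (.inl hj))
        ((testBit_addEdge s hu hw hne _ _).mpr (by simp))
    · subst h2
      exact key i w hi hw hadj hnew
        (fun j hj => (testBit_addEdge s hu hw hne _ _).mpr (.inl hj))
        ((testBit_addEdge s hu hw hne _ _).mpr (by simp))
    · rw [adjMask_addEdge s hu hw, if_neg h1, if_neg h2]
      exact h.slack i hi

open Classical in
theorem Realizes.addLeaves (h : Realizes G X s φ) (hX : ∀ v ∈ X, (nbrs G X v).card ≤ 3) {u : ℕ}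
    (hu : u < s.length)
    (hnew : ∀ w ∈ nbrs G X (φ u), (∀ j, (s.adjMask u).testBit j → w ≠ φ j) →
      ∀ j < s.length, w ≠ φ j) :
    ∃ k ≤ s.slack u, ∃ ψ, Realizes G X (s.addLeaves u k) ψ := by
  set U := (nbrs G X (φ u)).filter (fun w => ∀ j, (s.adjMask u).testBit j → w ≠ φ j) with hU
  have hUmem : ∀ w ∈ U, w ∈ X ∧ G.Adj (φ u) w ∧ ∀ j < s.length, w ≠ φ j := by
    intro w hw
    have hw' := hw
    rw [hU, Finset.mem_filter] at hw'
    have := hw'.1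
    rw [nbrs, Finset.mem_filter] at this
    exact ⟨this.1, this.2, hnew w hw'.1 hw'.2⟩
  obtain ⟨e⟩ : Nonempty (Fin U.card ≃ U) := ⟨U.equivFin.symm⟩
  refine ⟨U.card, h.slack u hu, fun i => if hi : i < s.length then φ i else
    if hi' : i - s.length < U.card then e ⟨i - s.length, hi'⟩ else φ u, ?_⟩
  set ψ : ℕ → V := fun i => if hi : i < s.length then φ i else
    if hi' : i - s.length < U.card then e ⟨i - s.length, hi'⟩ else φ u with hψ
  have ψold : ∀ i, i < s.length → ψ i = φ i := fun i hi => by simp [hψ, hi]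
  have ψnew : ∀ i, s.length ≤ i → i < s.length + U.card → ψ i ∈ U := fun i hi hi' => by
    simp only [hψ, not_lt.mpr hi, dite_false, show i - s.length < U.card by omega, dite_true]
    exact (e _).2
  have ψsurj : ∀ w ∈ U, ∃ i, s.length ≤ i ∧ i < s.length + U.card ∧ ψ i = w := by
    intro w hw
    obtain ⟨⟨i, hi⟩, hi'⟩ := e.surjective ⟨w, hw⟩
    refine ⟨s.length + i, by omega, by omega, ?_⟩
    simp [hψ, hi, hi']
  constructor
  · intro i hi
    rw [length_addLeaves] at hi
    by_cases h1 : i < s.length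
    · rw [ψold i h1]; exact h.mem i h1
    · exact (hUmem _ (ψnew i (by omega) hi)).1
  · intro i hi j hj hij
    rw [length_addLeaves] at hi hj
    by_cases h1 : i < s.length <;> by_cases h2 : j < s.length
    · rw [ψold i h1, ψold j h2] at hij
      exact h.inj i h1 j h2 hij
    · rw [ψold i h1] at hij
      exact absurd hij.symm ((hUmem _ (ψnew j (by omega) hj)).2.2 i h1)
    · rw [ψold j h2] at hij
      exact absurd hij ((hUmem _ (ψnew i (by omega) hi)).2.2 j h2)
    · simp only [hψ, h1, h2, dite_false, show i - s.length < U.card by omega,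
        show j - s.length < U.card by omega, dite_true] at hij
      have := congrArg Fin.val (e.injective (Subtype.ext hij))
      simp only at this
      omega
  · intro i j
    rw [testBit_addLeaves s hu, testBit_addLeaves s hu]
    rintro (h1 | h1 | h1)
    · exact .inl (h.symm _ _ h1)
    · exact .inr (.inr ⟨h1.2.1, h1.2.2, h1.1⟩)
    · exact .inr (.inl ⟨h1.2.2, h1.1, h1.2.1⟩)
  · intro i j
    rw [testBit_addLeaves s hu]
    rintro (h1 | ⟨rfl, h2, h3⟩ | ⟨h2, h3, rfl⟩)
    · rw [ψold i (lt_length_of_testBit h1), ψold j (h.lt_length h1)]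
      exact h.adj _ _ h1
    · rw [ψold i hu]
      exact (hUmem _ (ψnew j h2 h3)).2.1
    · rw [ψold j hu]
      exact (hUmem _ (ψnew i h2 h3)).2.1.symm
  · intro i hi
    rw [length_addLeaves] at hi
    rw [slack_addLeaves s hu _ hi]
    split_ifs with h1 h2
    · subst h2
      rw [Nat.le_zero, Finset.card_eq_zero, Finset.filter_eq_empty_iff]
      intro w hw hw'
      rw [ψold i h1] at hw
      have : w ∈ U := by
        rw [hU, Finset.mem_filter]
        refine ⟨hw, fun j hj => ?_⟩
        rw [← ψold j (h.lt_length hj)]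
        exact hw' j ((testBit_addLeaves s hu _ _ _).mpr (.inl hj))
      obtain ⟨j, hj1, hj2, rfl⟩ := ψsurj w this
      exact hw' j ((testBit_addLeaves s hu _ _ _).mpr (.inr (.inl ⟨rfl, hj1, hj2⟩))) rfl
    · refine le_trans (Finset.card_le_card ?_) (h.slack i h1)
      intro w hw
      rw [Finset.mem_filter, ψold i h1] at hw
      rw [Finset.mem_filter]
      refine ⟨hw.1, fun j hj => ?_⟩
      rw [← ψold j (h.lt_length hj)]
      exact hw.2 j ((testBit_addLeaves s hu _ _ _).mpr (.inl hj))
    · have hi' := hUmem _ (ψnew i (by omega) hi)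
      have h3 := hX (ψ i) hi'.1
      refine Nat.le_of_lt_succ (lt_of_lt_of_le (Finset.card_lt_card ?_) h3)
      rw [Finset.ssubset_iff_of_subset (Finset.filter_subset _ _)]
      refine ⟨φ u, ?_, ?_⟩
      · rw [nbrs, Finset.mem_filter]
        exact ⟨h.mem u hu, hi'.2.1.symm⟩
      · rw [Finset.mem_filter, not_and]
        intro _ h'
        exact h' u ((testBit_addLeaves s hu _ _ _).mpr (.inr (.inr ⟨by omega, hi, rfl⟩)))
          (ψold u hu).symm

open Classical in
theorem Realizes.exists_mem_children (h : Realizes G X s φ)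
    (hX : ∀ v ∈ X, (nbrs G X v).card ≤ 3) {u : ℕ} (hu : u < s.length) :
    ∃ t ∈ s.children u, ∃ ψ, Realizes G X t ψ := by
  by_cases hw : ∃ w < s.length, G.Adj (φ u) (φ w) ∧ ¬(s.adjMask u).testBit w
  · obtain ⟨w, hw, hadj, hnew⟩ := hw
    refine ⟨s.addEdge u w, ?_, φ, h.addEdge hu hw hadj hnew⟩
    refine List.mem_append_left _ (List.mem_map.mpr ⟨w, List.mem_filter.mpr
      ⟨List.mem_range.mpr hw, ?_⟩, rfl⟩)
    have h1 : w ≠ u := by rintro rfl; exact G.loopless.irrefl _ hadj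
    have h2 : s.slack w ≠ 0 := by
      have := h.slack w hw
      refine Nat.pos_iff_ne_zero.mp (lt_of_lt_of_le (Finset.card_pos.mpr ⟨φ u, ?_⟩) this)
      simp only [nbrs, Finset.mem_filter]
      exact ⟨⟨h.mem u hu, hadj.symm⟩, fun j hj e =>
        hnew (h.symm _ _ (h.inj u hu j (h.lt_length hj) e ▸ hj))⟩
    simp [h1, h2, hnew]
  · push Not at hw
    obtain ⟨k, hk, ψ, hψ⟩ := h.addLeaves hX hu (by
      intro w hw' hw'' j hj e
      subst e
      rw [nbrs, Finset.mem_filter] at hw'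
      exact hw'' j (hw j hj hw'.2) rfl)
    exact ⟨_, List.mem_append_right _ (List.mem_map.mpr
      ⟨k, List.mem_range.mpr (Nat.lt_succ_of_le hk), rfl⟩), ψ, hψ⟩

theorem testBit_foldr_lor {α : Type*} (l : List α) (f : α → ℕ) (j : ℕ) :
    (l.foldr (fun i acc => f i ||| acc) 0).testBit j ↔ ∃ i ∈ l, (f i).testBit j := by
  induction l with
  | nil => simp
  | cons a l ih => simp [ih]

theorem testBit_nbhdMask (s : Exploration) (A j : ℕ) :
    (s.nbhdMask A).testBit j ↔
      ∃ i < s.length, A.testBit i ∧ ((s.adjMask i).testBit j ∨ i = j) := by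
  rw [nbhdMask, testBit_foldr_lor]
  refine exists_congr fun i => ?_
  rw [List.mem_range]
  refine and_congr_right fun _ => ?_
  split_ifs with h
  · rw [Nat.testBit_or, testBit_one_shiftLeft, Bool.or_eq_true, decide_eq_true_eq]
    simp [h]
  · simp [h]

open Classical in
/-- The vertices with a label in the mask `A`. -/
noncomputable def labelled (φ : ℕ → V) (m A : ℕ) : Finset V :=
  ((Finset.range m).filter (fun i => A.testBit i)).image φ

open Classical in
theorem card_labelled (h : Realizes G X s φ) (A : ℕ) :
    (labelled φ s.length A).card = bitCount s.length A := by
  rw [labelled, Finset.card_image_of_injOn]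
  · simp [bitCount, Finset.card, Finset.filter, Finset.range, Multiset.range]
  · intro i hi j hj
    simp only [Finset.coe_filter, Finset.mem_range, Set.mem_ofPred_eq] at hi hj
    exact h.inj i hi.1 j hj.1

open Classical in
theorem Realizes.hasGain (h : Realizes G X s φ) {A Z : ℕ} (hg : s.isGain A Z) : HasGain G X := by
  simp only [isGain, Bool.and_eq_true, Nat.ble_eq, List.all_eq_true, List.mem_range,
    Bool.or_eq_true, Bool.not_eq_true', beq_iff_eq] at hg
  obtain ⟨⟨⟨hA, hZ⟩, hW⟩, hc⟩ := hg
  have hsub : ∀ B, labelled φ s.length B ⊆ X := by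
    intro B v hv
    simp only [labelled, Finset.mem_image, Finset.mem_filter, Finset.mem_range] at hv
    obtain ⟨i, ⟨hi, _⟩, rfl⟩ := hv
    exact h.mem i hi
  have hmask : ∀ j < s.length, (s.nbhdMask A).testBit j →
      φ j ∈ closedNbhd G (labelled φ s.length A : Set V) := by
    intro j hj hbit
    obtain ⟨i, hi, hAi, hij⟩ := (testBit_nbhdMask s A j).mp hbit
    refine mem_closedNbhd.mpr ⟨φ i, Finset.mem_image.mpr ⟨i, by simp [hi, hAi], rfl⟩, ?_⟩
    rcases hij with hij | rfl
    · exact .inr (h.adj _ _ hij)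
    · exact .inl rfl
  refine ⟨labelled φ s.length A, labelled φ s.length Z, ?_, ?_, hsub _, ?_, ?_⟩
  · rwa [card_labelled h]
  · rwa [card_labelled h]
  · intro z hz w hw hzw
    simp only [labelled, Finset.mem_image, Finset.mem_filter, Finset.mem_range] at hz
    obtain ⟨i, ⟨hi, hZi⟩, rfl⟩ := hz
    obtain hci | ⟨h0, hci⟩ := hc i hi
    · simp [hZi] at hci
    have h1 := h.slack i hi
    rw [h0, Nat.le_zero, Finset.card_eq_zero, Finset.filter_eq_empty_iff] at h1
    have h2 := h1 (show w ∈ nbrs G X (φ i) by simp [nbrs, hw, hzw])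
    push Not at h2
    obtain ⟨j, hj, rfl⟩ := h2
    have h3 : (s.nbhdMask A ||| Z).testBit j := by
      rw [← hci]; simp [hj]
    have hjl := h.lt_length hj
    simp only [Nat.testBit_or, Bool.or_eq_true] at h3
    rcases h3 with h3 | h3
    · exact .inr (hmask j hjl h3)
    · exact .inl (Finset.mem_image.mpr ⟨j, by simp [hjl, h3], rfl⟩)
  · rw [card_labelled h]
    refine le_trans (Nat.add_le_add_left hW _) ?_
    rw [← card_labelled h, ← Finset.card_union_of_disjoint]
    · refine Finset.card_le_card (Finset.union_subset ?_ (hsub _))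
      exact Finset.sdiff_subset.trans (Finset.filter_subset _ _)
    · rw [Finset.disjoint_left]
      intro v hv hv'
      simp only [labelled, Finset.mem_image, Finset.mem_filter, Finset.mem_range,
        Nat.testBit_or, Bool.or_eq_true] at hv'
      obtain ⟨j, ⟨hj, hbit⟩, rfl⟩ := hv'
      rw [Finset.mem_sdiff, remove, Finset.mem_filter] at hv
      rcases hbit with hbit | hbit
      · exact hv.1.2 (hmask j hj hbit)
      · exact hv.2 (Finset.mem_image.mpr ⟨j, by simp [hj, hbit], rfl⟩)

theorem exists_of_foldl_bind {α β : Type*} (g : α → β → Option β) (l : List α) (o : Option β)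
    {r : β} (h : l.foldl (fun o t => o.bind (g t)) o = some r) :
    o.isSome ∧ ∀ t ∈ l, ∃ b r', g t b = some r' := by
  induction l generalizing o with
  | nil => simp_all
  | cons a l ih =>
    rw [List.foldl_cons] at h
    obtain ⟨h1, h2⟩ := ih _ h
    obtain ⟨r', hr'⟩ := Option.isSome_iff_exists.mp h1
    obtain ⟨b, rfl, hb⟩ := Option.bind_eq_some_iff.mp hr'
    refine ⟨rfl, ?_⟩
    rintro t (_ | ⟨_, ht⟩)
    · exact ⟨b, r', hb⟩
    · exact h2 t ht

theorem Realizes.hasGain_or_octagon (hX : ∀ v ∈ X, (nbrs G X v).card ≤ 3) (f : ℕ)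
    (h : Realizes G X s φ) {cs r : List ℕ} (hv : verify f s cs = some r) :
    HasGain G X ∨ ∃ ψ, Realizes G X octagon ψ := by
  induction f generalizing s φ cs r with
  | zero => simp [verify] at hv
  | succ f ih =>
    cases cs with
    | nil => simp [verify] at hv
    | cons c cs =>
      rw [verify] at hv
      split_ifs at hv with h1 h2 h3
      · obtain ⟨t, ht, ψ, hψ⟩ := h.exists_mem_children hX h2
        obtain ⟨b, r', hb⟩ := (exists_of_foldl_bind _ _ _ hv).2 t ht
        exact ih hψ hb
      · rw [Bool.or_eq_true, decide_eq_true_eq] at h3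
        rcases h3 with h3 | rfl
        · exact .inl (h.hasGain h3)
        · exact .inr ⟨φ, h⟩

end Exploration

open Exploration in
/-- A subcubic graph with a vertex of degree at most `2` has a gain or a component `C₈`. -/
theorem hasGain_or_octagon {G : SimpleGraph V} {X : Finset V}
    (hX : ∀ v ∈ X, (nbrs G X v).card ≤ 3) {y : V} (hy : y ∈ X) (hdeg : (nbrs G X y).card ≤ 2) :
    HasGain G X ∨ ∃ φ, Realizes G X octagon φ := by
  classical
  have h : Realizes G X [(0, 2)] (fun _ => y) := by
    have h0 : ∀ i, adjMask [(0, 2)] i = 0 := by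
      intro i; cases i <;> simp [adjMask]
    refine ⟨fun _ _ => hy, ?_, ?_, ?_, ?_⟩
    · intro i hi j hj _
      simp only [List.length_singleton] at hi hj
      omega
    · intro i j; simp [h0]
    · intro i j; simp [h0]
    · intro i hi
      simp only [List.length_singleton, Nat.lt_one_iff] at hi
      subst hi
      exact (Finset.card_filter_le _ _).trans hdeg
  exact h.hasGain_or_octagon hX _ verify_certificate

/-! ### Vertex sets that keep all colors -/

theorem exists_adj_of_preconnected {G : SimpleGraph V} {S : Finset V}
    (hS : (G.induce (S : Set V)).Preconnected) (T : Set V) {a b : V} (ha : a ∈ S) (haT : a ∈ T)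
    (hb : b ∈ S) (hbT : b ∉ T) : ∃ x ∈ S, x ∈ T ∧ ∃ y ∈ S, y ∉ T ∧ G.Adj x y := by
  obtain ⟨p⟩ := hS ⟨a, ha⟩ ⟨b, hb⟩
  obtain ⟨d, -, h1, h2⟩ := p.exists_boundary_dart (Subtype.val ⁻¹' T) haT hbT
  exact ⟨d.fst, d.fst.2, h1, d.snd, d.snd.2, h2, d.adj⟩

theorem exists_two_le_card_nbrs {G : SimpleGraph V} {S : Finset V}
    (hS : (G.induce (S : Set V)).Preconnected) (h3 : 3 ≤ S.card) :
    ∃ v ∈ S, 2 ≤ (nbrs G S v).card := by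
  by_contra! hcon
  have huniq : ∀ v ∈ S, ∀ x ∈ S, ∀ y ∈ S, G.Adj v x → G.Adj v y → x = y := by
    intro v hv x hx y hy hvx hvy
    exact Finset.card_le_one.mp (Nat.le_of_lt_succ (hcon v hv)) x
      (by simp [nbrs, hx, hvx]) y (by simp [nbrs, hy, hvy])
  obtain ⟨a, b, c, ha, hb, hc, hab, hac, hbc⟩ := Finset.two_lt_card_iff.mp h3
  obtain ⟨a', ha', rfl, d, hd, hda, had⟩ :=
    exists_adj_of_preconnected hS {a} ha rfl hb (by simpa using hab.symm)
  obtain ⟨e, he, hea, hed⟩ : ∃ e ∈ S, e ≠ a' ∧ e ≠ d := by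
    by_cases h : b = d
    · exact ⟨c, hc, hac.symm, fun h' => hbc (h.trans h'.symm)⟩
    · exact ⟨b, hb, hab.symm, h⟩
  obtain ⟨x, hx, hxT, y, hy, hyT, hxy⟩ :=
    exists_adj_of_preconnected hS {a', d} ha' (by simp) he (by simp [hea, hed])
  simp only [Set.mem_insert_iff, Set.mem_singleton_iff, not_or] at hxT hyT
  rcases hxT with rfl | rfl
  · exact hyT.2 (huniq x hx y hy d hd hxy had)
  · exact hyT.1 (huniq x hx y hy a' ha' hxy had.symm)

/-- Some connected part of `X` has all the colors. -/
def Full (G : SimpleGraph V) {k : ℕ} (κ : Multicoloring V k) (X : Finset V) : Prop :=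
  ∃ S ⊆ X, (G.induce (S : Set V)).Preconnected ∧ HasAllColors κ (S : Set V)

/-- Some connected part of `X \ M(A)` has all the colors, for every set `A` of at most `t`
vertices. -/
def Resists (G : SimpleGraph V) {k : ℕ} (κ : Multicoloring V k) (t : ℕ) (X : Finset V) : Prop :=
  ∀ A : Finset V, A.card ≤ t → Full G κ (remove G A X)

variable {G : SimpleGraph V} {k : ℕ} {κ : Multicoloring V k} {X Y : Finset V} {t : ℕ}

theorem mem_remove {A : Finset V} {v : V} :
    v ∈ remove G A X ↔ v ∈ X ∧ v ∉ closedNbhd G (A : Set V) := by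
  simp [remove]

theorem remove_subset (A : Finset V) : remove G A X ⊆ X := by
  classical exact Finset.filter_subset _ _

theorem remove_empty : remove G ∅ X = X := by
  ext v; simp [mem_remove, closedNbhd]

theorem Full.mono (h : Full G κ X) (hXY : X ⊆ Y) : Full G κ Y := by
  obtain ⟨S, h1, h2⟩ := h
  exact ⟨S, h1.trans hXY, h2⟩

open Classical in
theorem Full.of_separated (h : Full G κ X) (hYX : ∀ z ∈ X \ Y, ∀ w ∈ X, G.Adj z w → w ∉ Y) :
    Full G κ Y ∨ Full G κ (X \ Y) := by
  obtain ⟨S, hSX, hS, hκ⟩ := h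
  by_cases h1 : S ⊆ Y
  · exact .inl ⟨S, h1, hS, hκ⟩
  · obtain ⟨z, hz, hzY⟩ := Finset.not_subset.mp h1
    refine .inr ⟨S, fun y hy => Finset.mem_sdiff.mpr ⟨hSX hy, fun hyY => ?_⟩, hS, hκ⟩
    obtain ⟨x, hx, hxY, w, hw, hwY, hxw⟩ :=
      exists_adj_of_preconnected hS (Y : Set V)ᶜ hz (by simpa using hzY) hy (by simpa using hyY)
    exact hYX x (Finset.mem_sdiff.mpr ⟨hSX hx, by simpa using hxY⟩) w (hSX hw) hxw
      (by simpa using hwY)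

theorem Resists.full (h : Resists G κ t X) : Full G κ X := by
  simpa only [remove_empty] using h ∅ (Nat.zero_le _)

open Classical in
theorem remove_remove (A B : Finset V) : remove G B (remove G A X) = remove G (A ∪ B) X := by
  ext v
  simp only [mem_remove, mem_closedNbhd, Finset.mem_union, or_and_right, exists_or, not_or,
    and_assoc]

theorem Resists.remove {A : Finset V} (h : Resists G κ t X) (hA : A.card ≤ t) :
    Resists G κ (t - A.card) (remove G A X) := by
  classical
  intro B hB
  rw [remove_remove]
  exact h _ ((Finset.card_union_le _ _).trans (by omega))

open Classical in
theorem Resists.of_separated {s : ℕ} (h : Resists G κ (s + t) X)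
    (hYX : ∀ z ∈ X \ Y, ∀ w ∈ X, G.Adj z w → w ∉ Y) :
    Resists G κ s Y ∨ Resists G κ t (X \ Y) := by
  by_contra! hcon
  obtain ⟨h1, h2⟩ := hcon
  simp only [Resists, not_forall] at h1 h2
  obtain ⟨A, hA, hA'⟩ := h1
  obtain ⟨B, hB, hB'⟩ := h2
  have h3 := h (A ∪ B) ((Finset.card_union_le _ _).trans (by omega))
  obtain h4 | h4 := h3.of_separated (Y := SecretMulticoloring.remove G (A ∪ B) Y) (by
    intro z hz w hw hzw hwY
    rw [Finset.mem_sdiff, mem_remove, mem_remove] at hz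
    exact hYX z (Finset.mem_sdiff.mpr ⟨hz.1.1, fun h => hz.2 ⟨h, hz.1.2⟩⟩) w (mem_remove.mp hw).1
      hzw (mem_remove.mp hwY).1)
  · refine hA' (h4.mono ?_)
    rw [← remove_remove]
    exact remove_subset _
  · refine hB' (h4.mono ?_)
    intro z hz
    rw [Finset.mem_sdiff, mem_remove, mem_remove] at hz
    rw [mem_remove, Finset.mem_sdiff]
    refine ⟨⟨hz.1.1, fun h => hz.2 ⟨h, hz.1.2⟩⟩, fun h => hz.1.2 ?_⟩
    rw [mem_closedNbhd] at h ⊢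
    obtain ⟨a, ha, h⟩ := h
    exact ⟨a, Finset.mem_union_right _ ha, h⟩

theorem card_remove_singleton {v : V} (hv : v ∈ X) :
    (remove G {v} X).card + ((nbrs G X v).card + 1) ≤ X.card := by
  classical
  have h1 : v ∉ nbrs G X v := by simp [nbrs]
  rw [← Finset.card_insert_of_notMem h1, ← Finset.card_union_of_disjoint]
  · refine Finset.card_le_card (Finset.union_subset (remove_subset _) ?_)
    exact Finset.insert_subset hv (Finset.filter_subset _ _)
  · rw [Finset.disjoint_left]
    intro w hw hw'
    rw [mem_remove, mem_closedNbhd] at hw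
    rw [Finset.mem_insert, nbrs, Finset.mem_filter] at hw'
    exact hw.2 ⟨v, by simp, hw'.imp id And.right⟩

/-- No set of at most four vertices has all the colors. -/
def NoSmallCover {k : ℕ} (κ : Multicoloring V k) : Prop :=
  ∀ S : Finset V, S.card ≤ 4 → ¬HasAllColors κ (S : Set V)

theorem Full.five_le_card (h : Full G κ X) (hκ : NoSmallCover κ) : 5 ≤ X.card := by
  obtain ⟨S, h1, -, h2⟩ := h
  by_contra hX
  exact hκ S ((Finset.card_le_card h1).trans (by omega)) h2

theorem Full.exists_two_le_card_nbrs (h : Full G κ X) (hκ : NoSmallCover κ) :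
    ∃ v ∈ X, 2 ≤ (nbrs G X v).card := by
  classical
  obtain ⟨S, h1, h2, h3⟩ := h
  have h5 : 5 ≤ S.card := Full.five_le_card (G := G) ⟨S, subset_rfl, h2, h3⟩ hκ
  obtain ⟨v, hv, hv2⟩ := SecretMulticoloring.exists_two_le_card_nbrs h2 (by omega)
  exact ⟨v, h1 hv, hv2.trans (Finset.card_le_card (Finset.filter_subset_filter _ h1))⟩

theorem Resists.lt_card (hκ : NoSmallCover κ) (h : Resists G κ t X) : 3 * t + 4 < X.card := by
  induction t generalizing X with
  | zero => exact h.full.five_le_card hκ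
  | succ t ih =>
    obtain ⟨v, hv, hv2⟩ := h.full.exists_two_le_card_nbrs hκ
    have h1 := ih (h.remove (A := {v}) (by simp))
    have h2 := card_remove_singleton (G := G) hv
    omega

theorem Resists.of_card_sdiff_le (hκ : NoSmallCover κ) (h : Resists G κ t X)
    (hYX : ∀ w ∈ X, w ∉ Y → ∀ z ∈ X, G.Adj w z → z ∉ Y)
    (hcard : ∀ Z : Finset V, (∀ z ∈ Z, z ∈ X ∧ z ∉ Y) → Z.card ≤ 4) : Resists G κ t Y := by
  classical
  refine (Resists.of_separated (s := t) (t := 0) h ?_).resolve_right fun h' => ?_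
  · intro z hz
    rw [Finset.mem_sdiff] at hz
    exact hYX z hz.1 hz.2
  · have := h'.full.five_le_card hκ
    have := hcard (X \ Y) (fun z hz => Finset.mem_sdiff.mp hz)
    omega

theorem HasGain.exists_resists (hκ : NoSmallCover κ) (hX : HasGain G X) :
    ∃ a ≤ 3, ∃ Y : Finset V, Y.card + (4 * a + 1) ≤ X.card ∧
      ∀ t, a ≤ t → Resists G κ t X → Resists G κ (t - a) Y := by
  classical
  obtain ⟨A, Z, hA, hZ, -, hZc, hcard⟩ := hX
  refine ⟨A.card, hA, remove G A X \ Z, by convert hcard, fun t hat h => ?_⟩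
  refine (h.remove hat).of_card_sdiff_le hκ ?_ ?_
  · intro w hw hwY z hz hwz hzY
    rw [Finset.mem_sdiff] at hwY hzY
    rw [mem_remove] at hz
    rcases hZc w (by tauto) z hz.1 hwz with h' | h'
    · exact hzY.2 h'
    · exact hz.2 h'
  · refine fun U hU => (Finset.card_le_card fun z hz => ?_).trans hZ
    have := hU z hz
    rw [Finset.mem_sdiff] at this
    tauto

/-! ### Cycles of length eight -/

/-- The pairs of labels at distance at least `3` in the octagon. -/
def farPair : Fin 12 → Fin 8 × Fin 8 :=
  ![(2, 3), (1, 4), (3, 4), (0, 5), (2, 5), (4, 5), (0, 6), (1, 6), (3, 6), (0, 7), (1, 7), (2, 7)]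

theorem exists_farPair (P : Fin 8 → Bool)
    (hP : ∀ i, ∃ j, P j ∧ i ≠ j ∧ ¬(Exploration.octagon.adjMask i).testBit j) :
    ∃ e, P (farPair e).1 ∧ P (farPair e).2 := by
  revert P
  decide +kernel

/-- Any nine pairs of labels at distance at least `3` are hit by some four labels. -/
theorem exists_hitting_mask : ∀ x y z : Fin 12, x ≠ y → x ≠ z → y ≠ z →
    ∃ A ∈ [15, 23, 43, 85, 170, 212, 232, 240, 153, 102], ∀ e : Fin 12,
      e = x ∨ e = y ∨ e = z ∨ A.testBit (farPair e).1 ∨ A.testBit (farPair e).2 := by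
  decide +kernel

theorem exists_hitting_set (I : Finset (Fin 12)) (hI : I.card ≤ 9) :
    ∃ A : Finset (Fin 8), A.card = 4 ∧ ∀ e ∈ I, (farPair e).1 ∈ A ∨ (farPair e).2 ∈ A := by
  have h3 : 2 < Iᶜ.card := by
    rw [Finset.card_compl, Fintype.card_fin]; omega
  obtain ⟨x, y, z, hx, hy, hz, hxy, hxz, hyz⟩ := Finset.two_lt_card_iff.mp h3
  obtain ⟨A, hA, h⟩ := exists_hitting_mask x y z hxy hxz hyz
  refine ⟨Finset.univ.filter (fun i : Fin 8 => A.testBit i), ?_, fun e he => ?_⟩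
  · have hcard : ∀ A ∈ [15, 23, 43, 85, 170, 212, 232, 240, 153, 102],
        (Finset.univ.filter (fun i : Fin 8 => A.testBit i)).card = 4 := by decide
    exact hcard A hA
  · simp only [Finset.mem_filter, Finset.mem_univ, true_and]
    simp only [Finset.mem_compl] at hx hy hz
    rcases h e with rfl | rfl | rfl | h
    · exact absurd he hx
    · exact absurd he hy
    · exact absurd he hz
    · exact h

open Exploration

open Classical in
/-- The vertices of a component `C₈`. -/
noncomputable def octagonSet (φ : ℕ → V) : Finset V := (Finset.range 8).image φ

theorem Exploration.Realizes.card_octagonSet {φ : ℕ → V} (h : Realizes G X octagon φ) :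
    (octagonSet φ).card = 8 := by
  classical
  rw [octagonSet, Finset.card_image_of_injOn, Finset.card_range]
  intro i hi j hj
  rw [Finset.coe_range, Set.mem_Iio] at hi hj
  exact h.inj i hi j hj

theorem Exploration.Realizes.octagonSet_subset {φ : ℕ → V} (h : Realizes G X octagon φ) :
    octagonSet φ ⊆ X := by
  classical
  intro v hv
  rw [octagonSet, Finset.mem_image] at hv
  obtain ⟨i, hi, rfl⟩ := hv
  exact h.mem i (Finset.mem_range.mp hi)

theorem Exploration.Realizes.mem_octagonSet_of_adj {φ : ℕ → V} (h : Realizes G X octagon φ)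
    {v w : V} (hv : v ∈ octagonSet φ) (hw : w ∈ X) (hvw : G.Adj v w) : w ∈ octagonSet φ := by
  classical
  rw [octagonSet, Finset.mem_image] at hv
  obtain ⟨i, hi, rfl⟩ := hv
  rw [Finset.mem_range] at hi
  have h1 := h.slack i hi
  have h2 : octagon.slack i = 0 :=
    (show ∀ i < 8, octagon.slack i = 0 by decide) i hi
  rw [h2, Nat.le_zero, Finset.card_eq_zero, Finset.filter_eq_empty_iff] at h1
  have h3 := h1 (show w ∈ nbrs G X (φ i) by simp [nbrs, hw, hvw])
  push Not at h3
  obtain ⟨j, hj, rfl⟩ := h3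
  exact Finset.mem_image.mpr ⟨j, Finset.mem_range.mpr (h.lt_length hj), rfl⟩

theorem Exploration.Realizes.not_resists_octagonSet {φ : ℕ → V} (h : Realizes G X octagon φ)
    (hκ : NoSmallCover κ) (hk : k ≤ 9) : ¬Resists G κ 1 (octagonSet φ) := by
  classical
  intro hres
  have hfar : ∀ c : Fin k, ∃ e, c ∈ κ (φ (farPair e).1) ∧ c ∈ κ (φ (farPair e).2) := by
    intro c
    obtain ⟨e, he⟩ := exists_farPair (fun i => decide (c ∈ κ (φ i))) (by
      intro i
      obtain ⟨S, hS, -, hall⟩ := hres {φ i} (by simp)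
      have hc : c ∈ ⋃ u ∈ (S : Set V), κ u := by rw [hall]; trivial
      simp only [Set.mem_iUnion, Finset.mem_coe, exists_prop] at hc
      obtain ⟨u, hu, hcu⟩ := hc
      obtain ⟨hu1, hu2⟩ := mem_remove.mp (hS hu)
      rw [octagonSet, Finset.mem_image] at hu1
      obtain ⟨j, hj, rfl⟩ := hu1
      rw [mem_closedNbhd] at hu2
      refine ⟨⟨j, Finset.mem_range.mp hj⟩, by simpa using hcu, ?_, ?_⟩
      · rintro rfl
        exact hu2 ⟨φ j, by simp, .inl rfl⟩
      · intro hbit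
        exact hu2 ⟨φ i, by simp, .inr (h.adj _ _ hbit)⟩)
    simp only [decide_eq_true_eq] at he
    exact ⟨e, he⟩
  choose f hf using hfar
  obtain ⟨A, hA, hhit⟩ := exists_hitting_set (Finset.univ.image f)
    (Finset.card_image_le.trans (by simpa using hk))
  refine hκ (A.image fun i : Fin 8 => φ i) (Finset.card_image_le.trans hA.le) ?_
  refine Set.eq_univ_of_forall fun c => ?_
  simp only [Set.mem_iUnion, Finset.mem_coe, exists_prop]
  rcases hhit (f c) (Finset.mem_image_of_mem _ (Finset.mem_univ c)) with hc | hc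
  · exact ⟨_, Finset.mem_image_of_mem _ hc, (hf c).1⟩
  · exact ⟨_, Finset.mem_image_of_mem _ hc, (hf c).2⟩

/-! ### Sets resisting few vertices are large -/

theorem Resists.nine_le_card (hκ : NoSmallCover κ) (hk : k ≤ 9) (h : Resists G κ 1 X) :
    9 ≤ X.card := by
  induction hn : X.card using Nat.strong_induction_on generalizing X with
  | _ n ih =>
    by_contra! hlt
    have hdeg : ∀ v ∈ X, (nbrs G X v).card ≤ 2 := by
      intro v hv
      have h1 := card_remove_singleton (G := G) hv
      have h2 := (h {v} (by simp)).five_le_card hκ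
      omega
    obtain ⟨y, hy, -⟩ := h.full.exists_two_le_card_nbrs hκ
    obtain hg | ⟨φ, hφ⟩ := hasGain_or_octagon (fun v hv => (hdeg v hv).trans (by omega)) hy
      (hdeg y hy)
    · obtain ⟨a, -, Y, hY, hres⟩ := hg.exists_resists hκ
      obtain rfl | rfl : a = 0 ∨ a = 1 := by omega
      · have := ih Y.card (by omega) (hres 1 (by omega) h) rfl
        omega
      · have := (hres 1 le_rfl h).full.five_le_card hκ
        omega
    · refine hφ.not_resists_octagonSet hκ hk ?_
      rwa [Finset.eq_of_subset_of_card_le hφ.octagonSet_subset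
        (by rw [hφ.card_octagonSet]; omega)]

/-- The counting step for a graph with a gain or a component `C₈`. -/
theorem not_resists_of_hasGain_or_octagon (hκ : NoSmallCover κ) (hk : k ≤ 9)
    (hX : HasGain G X ∨ ∃ φ, Realizes G X octagon φ) (ht1 : 1 ≤ t) (ht : t ≤ 4)
    (hcard : X.card ≤ 4 * t + 5) (hcard' : X.card = 4 * t + 5 → 3 ≤ t)
    (ih : ∀ (s : ℕ) (Y : Finset V), s ≤ t → Y.card < X.card → Y.card ≤ 4 * s + 4 →
      ¬Resists G κ s Y) : ¬Resists G κ t X := by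
  classical
  intro h
  obtain hg | ⟨φ, hφ⟩ := hX
  · obtain ⟨a, ha, Y, hY, hres⟩ := hg.exists_resists hκ
    exact ih (t - a) Y (by omega) (by omega) (by omega) (hres t (by omega) h)
  · have h' : Resists G κ ((t - 1) + 1) X := by rwa [Nat.sub_add_cancel ht1]
    have hcard8 := Finset.card_sdiff_add_card_eq_card hφ.octagonSet_subset
    rw [hφ.card_octagonSet] at hcard8
    obtain h1 | h1 := h'.of_separated (Y := X \ octagonSet φ) (by
      intro z hz w hw hzw hwY
      rw [Finset.sdiff_sdiff_eq_self hφ.octagonSet_subset] at hz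
      exact (Finset.mem_sdiff.mp hwY).2 (hφ.mem_octagonSet_of_adj hz hw hzw))
    · have := h1.lt_card hκ
      omega
    · rw [Finset.sdiff_sdiff_eq_self hφ.octagonSet_subset] at h1
      exact hφ.not_resists_octagonSet hκ hk h1

theorem not_resists_of_card_le (hκ : NoSmallCover κ) (hk : k ≤ 9) (ht : t ≤ 4)
    (hX : X.card ≤ 4 * t + 4) : ¬Resists G κ t X := by
  induction hn : X.card using Nat.strong_induction_on generalizing X t with
  | _ n ih =>
    intro h
    obtain rfl | rfl | ht2 : t = 0 ∨ t = 1 ∨ 2 ≤ t := by omega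
    · have := h.full.five_le_card hκ
      omega
    · have := h.nine_le_card hκ hk
      omega
    by_cases hdeg : ∀ v ∈ X, (nbrs G X v).card ≤ 2
    · obtain ⟨y, hy, -⟩ := h.full.exists_two_le_card_nbrs hκ
      refine not_resists_of_hasGain_or_octagon hκ hk (hasGain_or_octagon
        (fun v hv => (hdeg v hv).trans (by omega)) hy (hdeg y hy)) (by omega) ht (by omega)
        (by omega) ?_ h
      intro s Y hs hY hY'
      exact ih Y.card (by omega) (by omega) hY' rfl
    · push Not at hdeg
      obtain ⟨v, hv, hv3⟩ := hdeg
      have h1 := card_remove_singleton (G := G) hv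
      have h2 := h.remove (A := {v}) (by rw [Finset.card_singleton]; omega)
      rw [Finset.card_singleton] at h2
      exact ih _ (by omega) (by omega) (by omega) rfl h2

theorem not_resists_four [Fintype V] (hV : Fintype.card V = 21) (hκ : NoSmallCover κ)
    (hk : k ≤ 9) : ¬Resists G κ 4 Finset.univ := by
  classical
  intro h
  have hnbrs : ∀ v, (nbrs G Finset.univ v).card = G.degree v := by
    intro v
    rw [← G.card_neighborFinset_eq_degree]
    congr 1
    ext w
    simp [nbrs]
  by_cases hdeg : ∀ v, G.degree v ≤ 3
  · obtain ⟨y, hy⟩ : ∃ y, G.degree y ≤ 2 := by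
      by_contra! hcon
      have h3 : ∀ v, G.degree v = 3 := fun v => le_antisymm (hdeg v) (hcon v)
      have := G.sum_degrees_eq_twice_card_edges
      simp only [h3, Finset.sum_const, Finset.card_univ, hV, smul_eq_mul] at this
      omega
    refine not_resists_of_hasGain_or_octagon hκ hk (hasGain_or_octagon
      (fun v _ => (hnbrs v).trans_le (hdeg v)) (Finset.mem_univ y) ((hnbrs y).trans_le hy))
      (by omega) le_rfl (by simp [hV]) (by omega) ?_ h
    intro s Y hs _ hY
    exact not_resists_of_card_le hκ hk hs hY
  · push Not at hdeg
    obtain ⟨v, hv⟩ := hdeg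
    have h1 := card_remove_singleton (G := G) (Finset.mem_univ v)
    rw [hnbrs, Finset.card_univ, hV] at h1
    exact not_resists_of_card_le hκ hk (by simp) (by simp; omega)
      (h.remove (A := {v}) (by simp))

/-! ### The lower bound -/

theorem IsHighlyResistant.noSmallCover [Fintype V] {a : ℕ} (h : IsHighlyResistant G a κ)
    (ha : 4 ≤ a) (hV : a ≤ Fintype.card V) : NoSmallCover κ := by
  intro S hS hall
  obtain ⟨A, hSA, hA⟩ := Finset.exists_superset_card_eq (hS.trans ha) hV
  refine h.2 A hA (Set.eq_univ_of_univ_subset ?_)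
  rw [← hall]
  exact Set.biUnion_subset_biUnion_left (by exact_mod_cast hSA)

theorem IsHighlyResistant.resists [Fintype V] {a : ℕ} (h : IsHighlyResistant G a κ)
    (hV : a ≤ Fintype.card V) : Resists G κ a Finset.univ := by
  classical
  intro B hB
  obtain ⟨A, hBA, hA⟩ := Finset.exists_superset_card_eq hB hV
  obtain ⟨H, hH⟩ := h.1 A hA
  refine ⟨(Subtype.val '' H.supp).toFinset, ?_, ?_, ?_⟩
  · intro v hv
    rw [Set.mem_toFinset] at hv
    obtain ⟨⟨v, hv⟩, -, rfl⟩ := hv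
    refine mem_remove.mpr ⟨Finset.mem_univ _, fun h' => hv ?_⟩
    rw [mem_closedNbhd] at h' ⊢
    obtain ⟨b, hb, h'⟩ := h'
    exact ⟨b, hBA hb, h'⟩
  · rw [Set.coe_toFinset]
    have hconn := (H.connected_toSimpleGraph).preconnected
    rintro ⟨_, x, hx, rfl⟩ ⟨_, y, hy, rfl⟩
    have := hconn ⟨x, hx⟩ ⟨y, hy⟩
    exact this.map (⟨fun z => ⟨z.1.1, z.1, z.2, rfl⟩, fun {a b} hab => hab⟩ :
      H.toSimpleGraph →g G.induce (Subtype.val '' H.supp))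
  · rwa [Set.coe_toFinset]

theorem not_admits {k : ℕ} (hk : k ≤ 9) : ¬Admits 4 21 k := by
  rintro ⟨G, κ, h⟩
  exact not_resists_four (by simp) (h.noSmallCover le_rfl (by simp)) hk (h.resists (by simp))

/-! ### The example: `C₈ + C₈ + K₅` -/

/-- The disjoint union of two cycles of length `8` and a complete graph on `5` vertices. -/
def twoOctagonsAndClique : SimpleGraph (Fin 21) where
  Adj u v := u ≠ v ∧ u.val / 8 = v.val / 8 ∧
    (u.val / 8 = 2 ∨ (u.val + 1) % 8 = v.val % 8 ∨ (v.val + 1) % 8 = u.val % 8)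
  symm := ⟨fun u v h => ⟨h.1.symm, h.2.1.symm, by have := h.2; omega⟩⟩
  loopless := ⟨fun _ h => h.1 rfl⟩

instance : DecidableRel twoOctagonsAndClique.Adj := fun u v =>
  inferInstanceAs (Decidable (u ≠ v ∧ u.val / 8 = v.val / 8 ∧
    (u.val / 8 = 2 ∨ (u.val + 1) % 8 = v.val % 8 ∨ (v.val + 1) % 8 = u.val % 8)))

/-- The mask of the colors of a vertex. -/
def colorMask (u : Fin 21) : ℕ :=
  [544, 132, 259, 592, 12, 33, 400, 74, 25, 544, 68, 274, 641, 12, 288, 194, 3, 12, 48, 192, 768].getD u.val 0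

def tenColoring : Multicoloring (Fin 21) 10 := fun u => {c | (colorMask u).testBit c}

/-- The path that remains of the octagon containing `v` when the closed neighborhood of `v` is
deleted. -/
def oppositePath (v : Fin 21) : List (Fin 21) :=
  [2, 3, 4, 5, 6].map (fun i => Fin.ofNat 21 (v.val / 8 * 8 + (v.val + i) % 8))

theorem reachable_of_isChain {V : Type*} {G : SimpleGraph V} {s : Set V} (l : List V) (x : V)
    (hl : (x :: l).IsChain G.Adj) (hs : ∀ u ∈ x :: l, u ∈ s) :
    ∀ u (hu : u ∈ x :: l), (G.induce s).Reachable ⟨x, hs x List.mem_cons_self⟩ ⟨u, hs u hu⟩ := by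
  induction l generalizing x with
  | nil =>
    intro u hu
    obtain rfl := List.mem_singleton.mp hu
    rfl
  | cons y l ih =>
    intro u hu
    rw [List.isChain_cons_cons] at hl
    rcases List.mem_cons.mp hu with rfl | hu
    · rfl
    · refine SimpleGraph.Reachable.trans ?_
        (ih y hl.2 (fun w hw => hs w (List.mem_cons_of_mem _ hw)) u hu)
      exact SimpleGraph.Adj.reachable (by simpa using hl.1)

theorem exists_component_of_isChain {V : Type*} {G : SimpleGraph V} {s : Set V} {k : ℕ}
    {κ : Multicoloring V k} (l : List V) (hl : l.IsChain G.Adj) (hne : l ≠ [])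
    (hs : ∀ u ∈ l, u ∈ s) (hκ : ∀ c, ∃ u ∈ l, c ∈ κ u) :
    ∃ H : (G.induce s).ConnectedComponent, HasAllColors κ (Subtype.val '' H.supp) := by
  cases l with
  | nil => exact absurd rfl hne
  | cons x l =>
    refine ⟨(G.induce s).connectedComponentMk ⟨x, hs x List.mem_cons_self⟩, ?_⟩
    refine Set.eq_univ_of_forall fun c => ?_
    obtain ⟨u, hu, hc⟩ := hκ c
    simp only [Set.mem_iUnion, exists_prop]
    refine ⟨u, ⟨⟨u, hs u hu⟩, ?_, rfl⟩, hc⟩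
    rw [SimpleGraph.ConnectedComponent.mem_supp_iff, SimpleGraph.ConnectedComponent.eq]
    exact (reachable_of_isChain l x hl hs u hu).symm

theorem isChain_oppositePath : ∀ v : Fin 21, v.val < 16 →
    (oppositePath v).IsChain twoOctagonsAndClique.Adj := by
  decide +kernel

theorem oppositePath_colors : ∀ v : Fin 21, v.val < 16 → ∀ c, ∃ u ∈ oppositePath v,
    c ∈ tenColoring u := by
  unfold tenColoring
  simp only [Set.mem_ofPred_eq]
  decide +kernel

theorem oppositePath_separated : ∀ v : Fin 21, v.val < 16 → ∀ u ∈ oppositePath v, ∀ a : Fin 21,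
    (a.val / 8 = v.val / 8 → a = v) → ¬(u = a ∨ twoOctagonsAndClique.Adj a u) := by
  decide +kernel

theorem exists_missing_color : ((List.finRange 21).sublistsLen 4).all (fun l =>
    (List.finRange 10).any (fun c =>
      !(l.foldr (fun u acc => colorMask u ||| acc) 0).testBit c)) = true := by
  decide +kernel

theorem isResistant_tenColoring : IsResistant twoOctagonsAndClique 4 tenColoring := by
  intro A hA
  by_cases hclique : ∀ a ∈ A, a.val < 16
  · refine exists_component_of_isChain [16, 17, 18, 19, 20] (by decide) (by simp) ?_ ?_
    · intro u hu hu'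
      obtain ⟨a, ha, h⟩ := mem_closedNbhd.mp hu'
      have h1 := hclique a ha
      have h2 : 16 ≤ u.val :=
        (by decide : ∀ u ∈ ([16, 17, 18, 19, 20] : List (Fin 21)), 16 ≤ u.val) u hu
      rcases h with rfl | h
      · omega
      · have := h.2.1
        omega
    · exact (by decide : ∀ c : Fin 10, ∃ u ∈ ([16, 17, 18, 19, 20] : List (Fin 21)),
        (colorMask u).testBit c = true)
  · push Not at hclique
    obtain ⟨p, hp, hp16⟩ := hclique
    obtain ⟨v, hv, hvA⟩ : ∃ v : Fin 21, v.val < 16 ∧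
        ∀ a ∈ A, a.val / 8 = v.val / 8 → a = v := by
      have hblock : ∀ b : Fin 2, (A.filter (fun a => a.val / 8 = b.val)).card ≤ 1 →
          ∃ v : Fin 21, v.val < 16 ∧ ∀ a ∈ A, a.val / 8 = v.val / 8 → a = v := by
        intro b hb
        by_cases hne : ∃ v ∈ A, v.val / 8 = b.val
        · obtain ⟨v, hvA, hv⟩ := hne
          refine ⟨v, by omega, fun a ha hav => Finset.card_le_one.mp hb a ?_ v ?_⟩
          · simp [ha, hav, hv]
          · simp [hvA, hv]
        · push Not at hne
          exact ⟨⟨8 * b.val, by omega⟩, by simp only; omega,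
            fun a ha hav => absurd (by simp only at hav; omega) (hne a ha)⟩
      by_contra! hcon
      have h0 := lt_of_not_ge fun h => (hblock 0 h).elim fun v hv =>
        (hcon v hv.1).elim fun a ha => ha.2.2 (hv.2 a ha.1 ha.2.1)
      have h1 := lt_of_not_ge fun h => (hblock 1 h).elim fun v hv =>
        (hcon v hv.1).elim fun a ha => ha.2.2 (hv.2 a ha.1 ha.2.1)
      have hdisj : Disjoint (A.filter (fun a => a.val / 8 = (0 : Fin 2).val))
          (A.filter (fun a => a.val / 8 = (1 : Fin 2).val)) := by
        rw [Finset.disjoint_filter]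
        intro a _ h h'
        simp at h h'
        omega
      have hsub : (A.filter (fun a => a.val / 8 = (0 : Fin 2).val)) ∪
          (A.filter (fun a => a.val / 8 = (1 : Fin 2).val)) ⊆ A.erase p := by
        intro a ha
        rw [Finset.mem_union, Finset.mem_filter, Finset.mem_filter] at ha
        refine Finset.mem_erase.mpr ⟨?_, by tauto⟩
        rintro rfl
        simp at ha
        omega
      have := Finset.card_le_card hsub
      rw [Finset.card_union_of_disjoint hdisj, Finset.card_erase_of_mem hp] at this
      omega
    refine exists_component_of_isChain (oppositePath v) (isChain_oppositePath v hv)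
      (by simp [oppositePath]) ?_ (oppositePath_colors v hv)
    intro u hu hu'
    obtain ⟨a, ha, h⟩ := mem_closedNbhd.mp hu'
    exact oppositePath_separated v hv u hu a (hvA a ha) h

theorem isHighlyResistant_tenColoring :
    IsHighlyResistant twoOctagonsAndClique 4 tenColoring := by
  refine ⟨isResistant_tenColoring, fun A hA hall => ?_⟩
  have hl : (List.finRange 21).filter (· ∈ A) ∈ (List.finRange 21).sublistsLen 4 := by
    refine List.mem_sublistsLen.mpr ⟨List.filter_sublist, ?_⟩
    rw [← hA, ← List.toFinset_card_of_nodup ((List.nodup_finRange 21).filter _)]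
    congr 1
    ext u
    simp
  obtain ⟨c, -, hc⟩ := List.any_eq_true.mp (List.all_eq_true.mp exists_missing_color _ hl)
  have hmem : c ∈ ⋃ u ∈ (A : Set (Fin 21)), tenColoring u := by rw [hall]; trivial
  simp only [Set.mem_iUnion, Finset.mem_coe, exists_prop] at hmem
  obtain ⟨u, hu, huc⟩ := hmem
  rw [Bool.not_eq_true', ← Bool.not_eq_true] at hc
  refine hc ((Exploration.testBit_foldr_lor _ colorMask c).mpr ⟨u, ?_, huc⟩)
  simpa using hu

end SecretMulticoloring

open SecretMulticoloring in
theorem theorem13 : SecretMulticoloring.K 4 21 = 10 := by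
  refine le_antisymm (sInf_le ⟨10, rfl, _, _, isHighlyResistant_tenColoring⟩) (le_sInf ?_)
  rintro _ ⟨k, rfl, hk⟩
  have h : 10 ≤ k := by
    by_contra! h
    exact not_admits (Nat.le_of_lt_succ h) hk
  exact_mod_cast h
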